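/- Let $\mathbb K\in\{\mathbb R,\mathbb C\}$, let $X$ and $U$ be Banach spaces over $\mathbb K$, and let $A$ be the generator of a $C_0$-semigroup $(T(t))_{t\ge 0}$ on $X$. Fix $\beta\in\rho(A)$, let $X_{-1}$ be the completion of $X$ with respect to the norm $\|x\|_{X_{-1}}=\|(\beta-A)^{-1}x\|_X$, let $T_{-1}(t)$ be the continuous extension of $T(t)$ to $X_{-1}$, and let $B:U\to X_{-1}$ be a bounded linear operator. For $x_0\in X$ and $u\in L^1_{loc}(0,\infty;U)$ let $$x(t)=T(t)x_0+\int_0^t T_{-1}(t-s)Bu(s)\,ds\in X_{-1},\qquad t\ge 0,$$ be the mild solution of the system $\Sigma(A,B)$: $\dot x(t)=Ax(t)+Bu(t)$, $x(0)=x_0$. Let $\mathbb R_0^+=[0,\infty)$. Let $\mathcal K$ be the set of continuous, strictly increasing $\mu:\mathbb R_0^+\to\mathbb R_0^+$ with $\mu(0)=0$; $\mathcal K_\infty$ the set of unbounded elements of $\mathcal K$; $\mathcal L$ the set of continuous, strictly decreasing $\gamma:\mathbb R_0^+\to\mathbb R_0^+$ with $\lim_{t\to\infty}\gamma(t)=0$;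 and $\mathcal{KL}$ the set of $b:(\mathbb R_0^+)^2\to\mathbb R_0^+$ with $b(\cdot,t)\in\mathcal K$ for all $t\ge0$ and $b(s,\cdot)\in\mathcal L$ for all $s>0$. A Young function is a function $\Phi:[0,\infty)\to\mathbb R$ of the form $\Phi(t)=\int_0^t\varphi(s)\,ds$, where $\varphi:[0,\infty)\to\mathbb R$ is right-continuous and nondecreasing, $\varphi(0)=0$, $\varphi(s)>0$ for $s>0$, and $\lim_{s\to\infty}\varphi(s)=\infty$. $L_\Phi(0,t;U)$ is the space of (classes of) Bochner-measurable $u:(0,t)\to U$ with $\int_0^t\Phi(k^{-1}\|u(s)\|_U)\,ds<\infty$ for some $k>0$, with the Luxemburg norm $\|u\|_\Phi=\inf\{k>0:\int_0^t\Phi(k^{-1}\|u(s)\|_U)\,ds\le 1\}$, and $E_\Phi(0,t;U)$ is the closure of $L^\infty(0,t;U)$ in $L_\Phi(0,t;U)$, with the same norm. For $Z=L^1$ or $Z=E_\Phi$, the system $\Sigma(A,B)$ is called $Z$-ISS if there exist $b\in\mathcal{KL}$ and $\mu\in\mathcal K_\infty$ such that for all $t\ge0$, $x_0\in X$ and $u\in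 Z(0,t;U)$ one has $x(t)\in X$ and $$\|x(t)\|\le b(\|x_0\|,t)+\mu(\|u\|_{Z(0,t;U)}),$$ and $Z$-iISS if there exist $b\in\mathcal{KL}$, $\theta\in\mathcal K_\infty$ and $\mu\in\mathcal K$ such that for all $t\ge0$, $x_0\in X$ and $u\in Z(0,t;U)$ one has $x(t)\in X$ and $$\|x(t)\|\le b(\|x_0\|,t)+\theta\Big(\int_0^t\mu(\|u(s)\|_U)\,ds\Big),$$ where the last inequality is void if the integral is infinite. Then the following statements are equivalent: (i) $\Sigma(A,B)$ is $L^1$-ISS; (ii) $\Sigma(A,B)$ is $L^1$-iISS; (iii) $\Sigma(A,B)$ is $E_\Phi$-ISS for every Young function $\Phi$. -/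

import Mathlib

open MeasureTheory Filter Topology Set
open scoped NNReal ENNReal

/-! ### Strongly continuous semigroups, generators and resolvents -/

/-- A strongly continuous semigroup (`C₀`-semigroup) of bounded operators on `X`. -/
structure C0Semigroup (𝕜 X : Type*) [RCLike 𝕜] [NormedAddCommGroup X] [NormedSpace 𝕜 X] where
  /-- The operator `T(t)`, for `t ≥ 0`. -/
  op : ℝ≥0 → X →L[𝕜] X
  op_zero : op 0 = ContinuousLinearMap.id 𝕜 X
  op_add : ∀ s t : ℝ≥0, op (s + t) = (op s).comp (op t)
  continuous_orbit : ∀ x : X, Continuous fun t : ℝ≥0 => op t x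

namespace C0Semigroup

section

variable {𝕜 X : Type*} [RCLike 𝕜] [NormedAddCommGroup X] [NormedSpace 𝕜 X]

/-- `y` is the derivative at `0` of the orbit of `x`: `(T(h)x - x)/h → y` as `h ↘ 0`. -/
def HasGenerator (T : C0Semigroup 𝕜 X) (x y : X) : Prop :=
  Tendsto (fun h : ℝ≥0 => (((h : ℝ) : 𝕜))⁻¹ • (T.op h x - x)) (𝓝[>] 0) (𝓝 y)

theorem HasGenerator.unique {T : C0Semigroup 𝕜 X} {x y z : X} (h₁ : T.HasGenerator x y)
    (h₂ : T.HasGenerator x z) : y = z :=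
  tendsto_nhds_unique h₁ h₂

theorem HasGenerator.add {T : C0Semigroup 𝕜 X} {x y x' y' : X} (h₁ : T.HasGenerator x y)
    (h₂ : T.HasGenerator x' y') : T.HasGenerator (x + x') (y + y') := by
  refine (Tendsto.add h₁ h₂).congr fun h => ?_
  rw [← smul_add, map_add]
  congr 1
  abel

theorem HasGenerator.smul {T : C0Semigroup 𝕜 X} {x y : X} (c : 𝕜) (h₁ : T.HasGenerator x y) :
    T.HasGenerator (c • x) (c • y) := by
  refine (Tendsto.const_smul h₁ c).congr fun h => ?_
  rw [map_smul, ← smul_sub, smul_comm]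

theorem HasGenerator.zero (T : C0Semigroup 𝕜 X) : T.HasGenerator 0 0 := by
  simp [HasGenerator]

/-- The generator `A` of the semigroup, with domain `D(A)` the set of all `x` for which
`(T(h)x - x)/h` converges as `h ↘ 0`, and with `A x` the limit. -/
noncomputable def generator (T : C0Semigroup 𝕜 X) : X →ₗ.[𝕜] X where
  domain :=
    { carrier := {x | ∃ y, T.HasGenerator x y}
      add_mem' := fun ⟨_, h₁⟩ ⟨_, h₂⟩ => ⟨_, h₁.add h₂⟩
      zero_mem' := ⟨0, HasGenerator.zero T⟩
      smul_mem' := fun c _ ⟨_, h⟩ => ⟨_, h.smul c⟩ }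
  toFun :=
    { toFun := fun x => Classical.choose x.2
      map_add' := fun x y => HasGenerator.unique (Classical.choose_spec (x + y).2)
        ((Classical.choose_spec x.2).add (Classical.choose_spec y.2))
      map_smul' := fun c x => HasGenerator.unique (Classical.choose_spec (c • x).2)
        ((Classical.choose_spec x.2).smul c) }

theorem generator_spec (T : C0Semigroup 𝕜 X) (x : T.generator.domain) :
    T.HasGenerator (x : X) (T.generator x) :=
  Classical.choose_spec x.2

theorem HasGenerator.mem_domain {T : C0Semigroup 𝕜 X} {x y : X} (h : T.HasGenerator x y) :
    x ∈ T.generator.domain :=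
  ⟨y, h⟩

/-- `R` is a bounded two-sided inverse of `β - A : D(A) → X`. -/
def IsResolventAt (T : C0Semigroup 𝕜 X) (β : 𝕜) (R : X →L[𝕜] X) : Prop :=
  (∀ x : X, ∃ h : R x ∈ T.generator.domain, β • R x - T.generator ⟨R x, h⟩ = x) ∧
    ∀ x : T.generator.domain, R (β • (x : X) - T.generator x) = x

/-- The resolvent set `ρ(A)` of the generator `A`. -/
def rho (T : C0Semigroup 𝕜 X) : Set 𝕜 :=
  {β | ∃ R : X →L[𝕜] X, T.IsResolventAt β R}

/-- The resolvent operator `(β - A)⁻¹` for `β ∈ ρ(A)`. -/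
noncomputable def resolvent (T : C0Semigroup 𝕜 X) (β : T.rho) : X →L[𝕜] X :=
  Classical.choose β.2

theorem resolvent_spec (T : C0Semigroup 𝕜 X) (β : T.rho) :
    T.IsResolventAt (β : 𝕜) (T.resolvent β) :=
  Classical.choose_spec β.2

theorem resolvent_injective (T : C0Semigroup 𝕜 X) (β : T.rho) :
    Function.Injective (T.resolvent β) := by
  intro x y hxy
  obtain ⟨h₁, e₁⟩ := (T.resolvent_spec β).1 x
  obtain ⟨h₂, e₂⟩ := (T.resolvent_spec β).1 y
  rw [← e₁, ← e₂]
  have hs : (⟨T.resolvent β x, h₁⟩ : T.generator.domain) = ⟨T.resolvent β y, h₂⟩ :=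
    Subtype.ext hxy
  rw [hs, hxy]

theorem op_comm (T : C0Semigroup 𝕜 X) (s t : ℝ≥0) (x : X) :
    T.op s (T.op t x) = T.op t (T.op s x) := by
  have h : (T.op s).comp (T.op t) = (T.op t).comp (T.op s) := by
    rw [← T.op_add, ← T.op_add, add_comm]
  exact DFunLike.congr_fun h x

theorem HasGenerator.op {T : C0Semigroup 𝕜 X} {x y : X} (t : ℝ≥0) (h : T.HasGenerator x y) :
    T.HasGenerator (T.op t x) (T.op t y) := by
  refine (((T.op t).continuous.tendsto y).comp h).congr fun s => ?_
  simp [map_smul, map_sub, T.op_comm t s x]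

theorem resolvent_op (T : C0Semigroup 𝕜 X) (β : T.rho) (t : ℝ≥0) (x : X) :
    T.resolvent β (T.op t x) = T.op t (T.resolvent β x) := by
  obtain ⟨h, e⟩ := (T.resolvent_spec β).1 x
  have hg := (T.generator_spec ⟨T.resolvent β x, h⟩).op t
  have hd := hg.mem_domain
  have hA : T.generator ⟨_, hd⟩ = T.op t (T.generator ⟨T.resolvent β x, h⟩) :=
    (T.generator_spec ⟨_, hd⟩).unique hg
  have h2 := (T.resolvent_spec β).2 ⟨_, hd⟩
  rw [hA] at h2
  have e2 : (β : 𝕜) • T.op t (T.resolvent β x) -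
      T.op t (T.generator ⟨T.resolvent β x, h⟩) = T.op t x := by
    rw [← map_smul, ← map_sub, e]
  exact (congrArg (T.resolvent β) e2).symm.trans h2

/-! ### The extrapolation space -/

/-- A copy of `X`, to be equipped with the norm `x ↦ ‖(β - A)⁻¹ x‖`. -/
def PreExtrap (T : C0Semigroup 𝕜 X) (_β : T.rho) : Type _ := X

instance (T : C0Semigroup 𝕜 X) (β : T.rho) : AddCommGroup (T.PreExtrap β) :=
  inferInstanceAs (AddCommGroup X)

instance (T : C0Semigroup 𝕜 X) (β : T.rho) : Module 𝕜 (T.PreExtrap β) :=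
  inferInstanceAs (Module 𝕜 X)

/-- The identity map from `X` to its copy. -/
def toPre (T : C0Semigroup 𝕜 X) (β : T.rho) : X ≃ₗ[𝕜] T.PreExtrap β :=
  LinearEquiv.refl 𝕜 X

/-- The resolvent as a linear map on the copy of `X`. -/
noncomputable def resolventPre (T : C0Semigroup 𝕜 X) (β : T.rho) : T.PreExtrap β →ₗ[𝕜] X :=
  (T.resolvent β : X →ₗ[𝕜] X).comp ((T.toPre β).symm : T.PreExtrap β →ₗ[𝕜] X)

noncomputable instance (T : C0Semigroup 𝕜 X) (β : T.rho) :
    NormedAddCommGroup (T.PreExtrap β) :=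
  NormedAddCommGroup.induced (T.PreExtrap β) X (T.resolventPre β)
    ((T.resolvent_injective β).comp (T.toPre β).symm.injective)

theorem norm_pre (T : C0Semigroup 𝕜 X) (β : T.rho) (x : T.PreExtrap β) :
    ‖x‖ = ‖T.resolvent β ((T.toPre β).symm x)‖ := rfl

noncomputable instance (T : C0Semigroup 𝕜 X) (β : T.rho) :
    NormedSpace 𝕜 (T.PreExtrap β) where
  norm_smul_le c x := by
    rw [norm_pre, norm_pre, map_smul, map_smul, norm_smul]

noncomputable instance (T : C0Semigroup 𝕜 X) (β : T.rho) : NormedSpace ℝ (T.PreExtrap β) :=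
  NormedSpace.restrictScalars ℝ 𝕜 (T.PreExtrap β)

instance (T : C0Semigroup 𝕜 X) (β : T.rho) : IsScalarTower ℝ 𝕜 (T.PreExtrap β) :=
  IsScalarTower.of_algebraMap_smul fun _ _ => rfl

/-- The extrapolation space `X₋₁`: the completion of `X` with respect to
`‖x‖₋₁ = ‖(β - A)⁻¹ x‖`. -/
abbrev Extrap (T : C0Semigroup 𝕜 X) (β : T.rho) : Type _ :=
  UniformSpace.Completion (T.PreExtrap β)

/-- The canonical embedding of `X` into `X₋₁`. -/
noncomputable def incl (T : C0Semigroup 𝕜 X) (β : T.rho) : X →ₗ[𝕜] T.Extrap β :=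
  (UniformSpace.Completion.toComplL (𝕜 := 𝕜) (E := T.PreExtrap β)).toLinearMap.comp
    (T.toPre β : X →ₗ[𝕜] T.PreExtrap β)

theorem norm_incl (T : C0Semigroup 𝕜 X) (β : T.rho) (x : X) :
    ‖T.incl β x‖ = ‖T.resolvent β x‖ :=
  UniformSpace.Completion.norm_coe (E := T.PreExtrap β) (T.toPre β x)

/-- The operator `T(t)` on `X` with the norm `‖·‖₋₁`. -/
noncomputable def opPre (T : C0Semigroup 𝕜 X) (β : T.rho) (t : ℝ≥0) :
    T.PreExtrap β →L[𝕜] T.PreExtrap β :=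
  LinearMap.mkContinuous
    ((T.toPre β : X →ₗ[𝕜] T.PreExtrap β).comp
      ((T.op t : X →ₗ[𝕜] X).comp ((T.toPre β).symm : T.PreExtrap β →ₗ[𝕜] X)))
    ‖T.op t‖ fun x => by
      rw [norm_pre, norm_pre]
      simp only [LinearMap.comp_apply, LinearEquiv.coe_coe, LinearEquiv.symm_apply_apply,
        ContinuousLinearMap.coe_coe]
      rw [T.resolvent_op]
      exact (T.op t).le_opNorm _

/-- The operator `T₋₁(t)`: the unique continuous extension of `T(t)` to `X₋₁`. -/
noncomputable def opExtrap (T : C0Semigroup 𝕜 X) (β : T.rho) (t : ℝ≥0) :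
    T.Extrap β →L[𝕜] T.Extrap β :=
  (T.opPre β t).completion

theorem opExtrap_incl (T : C0Semigroup 𝕜 X) (β : T.rho) (t : ℝ≥0) (x : X) :
    T.opExtrap β t (T.incl β x) = T.incl β (T.op t x) :=
  ContinuousLinearMap.completion_apply_coe (T.opPre β t) (T.toPre β x)

/-! ### Mild solutions -/

/-- The mild solution at time `t`, as an element of `X₋₁`:
`T(t)x₀ + ∫₀ᵗ T₋₁(t-s) B u(s) ds`. -/
noncomputable def mildSolution {U : Type*} [NormedAddCommGroup U] [NormedSpace 𝕜 U]
    (T : C0Semigroup 𝕜 X) (β : T.rho) (B : U →L[𝕜] T.Extrap β) (x₀ : X) (u : ℝ → U)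
    (t : ℝ≥0) : T.Extrap β :=
  T.incl β (T.op t x₀) + ∫ s in (0 : ℝ)..t, T.opExtrap β ((t : ℝ) - s).toNNReal (B (u s))

end

end C0Semigroup

/-! ### Comparison functions -/

/-- The class `𝒦`. -/
structure IsClassK (μ : ℝ≥0 → ℝ≥0) : Prop where
  map_zero : μ 0 = 0
  continuous : Continuous μ
  strictMono : StrictMono μ

/-- The class `𝒦_∞`. -/
structure IsClassKInfty (θ : ℝ≥0 → ℝ≥0) : Prop extends IsClassK θ where
  tendsto : Tendsto θ atTop atTop

/-- The class `ℒ`. -/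
structure IsClassL (γ : ℝ≥0 → ℝ≥0) : Prop where
  continuous : Continuous γ
  strictAnti : StrictAnti γ
  tendsto : Tendsto γ atTop (𝓝 0)

/-- The class `𝒦ℒ`. -/
structure IsClassKL (b : ℝ≥0 → ℝ≥0 → ℝ≥0) : Prop where
  classK : ∀ t, IsClassK fun s => b s t
  classL : ∀ s, 0 < s → IsClassL (b s)

/-! ### Input spaces -/

/-- A family of spaces `Z(0,t;U)` of input functions on `(0,t)`. Functions are represented by
functions on `ℝ` of which only the restriction to `(0,t)` matters; `norm t` is the norm of
`Z(0,t;U)`, meaningful on members of `carrier t`. -/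
structure InputSpaces (U : Type*) where
  carrier : ℝ≥0 → Set (ℝ → U)
  norm : ℝ≥0 → (ℝ → U) → ℝ≥0

section

variable (U : Type*) [NormedAddCommGroup U]

/-- The interval `(0,t)` with Lebesgue measure. -/
noncomputable def intervalMeasure (t : ℝ≥0) : Measure ℝ :=
  volume.restrict (Ioo (0 : ℝ) t)

/-- The spaces `L¹(0,t;U)`. -/
noncomputable def inputL1 : InputSpaces U where
  carrier t := {u | MemLp u 1 (intervalMeasure t)}
  norm t u := (eLpNorm u 1 (intervalMeasure t)).toNNReal

/-- `Φ` is a Young function: `Φ(t) = ∫₀ᵗ φ(s) ds` with `φ` right-continuous, nondecreasing,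
`φ(0) = 0`, `φ > 0` on `(0,∞)` and `φ(s) → ∞` as `s → ∞`. -/
def IsYoungFunction (Φ : ℝ≥0 → ℝ≥0) : Prop :=
  ∃ φ : ℝ≥0 → ℝ≥0,
    (∀ s, ContinuousWithinAt φ (Ici s) s) ∧ Monotone φ ∧ φ 0 = 0 ∧ (∀ s, 0 < s → 0 < φ s) ∧
    Tendsto φ atTop atTop ∧
    ∀ t : ℝ≥0, (Φ t : ℝ) = ∫ s in (0 : ℝ)..t, (φ s.toNNReal : ℝ)

variable {U}

/-- Membership in the Orlicz space `L_Φ(0,t;U)`. -/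
def MemOrlicz (Φ : ℝ≥0 → ℝ≥0) (t : ℝ≥0) (u : ℝ → U) : Prop :=
  AEStronglyMeasurable u (intervalMeasure t) ∧
    ∃ k : ℝ≥0, 0 < k ∧ ∫⁻ s, (Φ (k⁻¹ * ‖u s‖₊) : ℝ≥0∞) ∂(intervalMeasure t) < ∞

/-- The Luxemburg norm on `L_Φ(0,t;U)`. -/
noncomputable def luxemburgNorm (Φ : ℝ≥0 → ℝ≥0) (t : ℝ≥0) (u : ℝ → U) : ℝ≥0 :=
  sInf {k : ℝ≥0 | 0 < k ∧ ∫⁻ s, (Φ (k⁻¹ * ‖u s‖₊) : ℝ≥0∞) ∂(intervalMeasure t) ≤ 1}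

variable (U)

/-- The spaces `E_Φ(0,t;U)`: the closure of `L^∞(0,t;U)` in `L_Φ(0,t;U)`, with the Luxemburg
norm. -/
noncomputable def inputE (Φ : ℝ≥0 → ℝ≥0) : InputSpaces U where
  carrier t := {u | MemOrlicz Φ t u ∧ ∀ ε : ℝ≥0, 0 < ε →
    ∃ v : ℝ → U, MemLp v ∞ (intervalMeasure t) ∧ luxemburgNorm Φ t (u - v) < ε}
  norm t u := luxemburgNorm Φ t u

end

/-! ### Stability notions -/

section

variable {𝕜 X U : Type*} [RCLike 𝕜] [NormedAddCommGroup X] [NormedSpace 𝕜 X]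
  [NormedAddCommGroup U] [NormedSpace 𝕜 U]

/-- Input-to-state stability of `Σ(A,B)` with respect to `Z`. -/
def IsISS (T : C0Semigroup 𝕜 X) (β : T.rho) (B : U →L[𝕜] T.Extrap β) (Z : InputSpaces U) :
    Prop :=
  ∃ (b : ℝ≥0 → ℝ≥0 → ℝ≥0) (μ : ℝ≥0 → ℝ≥0), IsClassKL b ∧ IsClassKInfty μ ∧
    ∀ (t : ℝ≥0) (x₀ : X), ∀ u ∈ Z.carrier t,
      ∃ x : X, T.incl β x = T.mildSolution β B x₀ u t ∧
        ‖x‖₊ ≤ b ‖x₀‖₊ t + μ (Z.norm t u)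

/-- Integral input-to-state stability of `Σ(A,B)` with respect to `Z`. The integral may be
infinite, in which case the estimate is void, but the state still has to lie in `X`. -/
def IsIISS (T : C0Semigroup 𝕜 X) (β : T.rho) (B : U →L[𝕜] T.Extrap β) (Z : InputSpaces U) :
    Prop :=
  ∃ (b : ℝ≥0 → ℝ≥0 → ℝ≥0) (θ μ : ℝ≥0 → ℝ≥0), IsClassKL b ∧ IsClassKInfty θ ∧ IsClassK μ ∧
    ∀ (t : ℝ≥0) (x₀ : X), ∀ u ∈ Z.carrier t,
      ∃ x : X, T.incl β x = T.mildSolution β B x₀ u t ∧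
        (∫⁻ s, (μ ‖u s‖₊ : ℝ≥0∞) ∂(intervalMeasure t) < ∞ →
          ‖x‖₊ ≤ b ‖x₀‖₊ t +
            θ (∫⁻ s, (μ ‖u s‖₊ : ℝ≥0∞) ∂(intervalMeasure t)).toNNReal)

end

/-! ### Bounded semigroups and the forced response -/

namespace C0Semigroup

section

variable {𝕜 X U : Type*} [RCLike 𝕜] [NormedAddCommGroup X] [NormedSpace 𝕜 X]
  [NormedAddCommGroup U] [NormedSpace 𝕜 U]

/-! All three statements amount to two facts: the semigroup has a `𝒦ℒ` decay bound (`IsStableWith`),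
and the response at time one to every `L¹` input lies in `X` (`IsL1Admissible`). Decay is the case
of zero input. Admissibility is immediate from (ii), where only membership of the state in `X` is
used. From (iii) it follows because every integrable `u` lies in some `E_Φ`, with `Φ` depending on
`u` (de la Vallée Poussin, `exists_isYoungFunction_lintegral_lt_top`).

Conversely, no uniformity in `u` is needed: the closed graph theorem turns admissibility into a
bound by the `L¹` norm (`exists_bound_forced_one`), and boundedness of the semigroup makes that
bound uniform in time (`exists_forced_bound`). This gives (i), and (ii) follows with `μ = id`.

For (iii) the `L¹` norm over the whole of `(0,t)` is too large, since `u` is controlled by `Φ(u)`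
only up to an additive constant, which integrates to something of order `t`. Decay repairs this:
with `‖T(τ)‖ ≤ 1/2` the contributions of past windows of length `τ` form a geometric series, so only
the supremum of the `L¹` norms over windows matters (`exists_forced_le_of_window`), and the
Luxemburg norm controls that independently of `t`. -/

theorem incl_injective (T : C0Semigroup 𝕜 X) (β : T.rho) : Function.Injective (T.incl β) := by
  refine (injective_iff_map_eq_zero _).2 fun x hx => ?_
  have h : ‖T.resolvent β x‖ = 0 := by rw [← T.norm_incl, hx, norm_zero]
  exact T.resolvent_injective β (by rw [norm_eq_zero.1 h, map_zero])

theorem continuous_incl (T : C0Semigroup 𝕜 X) (β : T.rho) : Continuous (T.incl β) :=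
  AddMonoidHomClass.continuous_of_bound (T.incl β) ‖T.resolvent β‖ fun x => by
    rw [T.norm_incl]
    exact (T.resolvent β).le_opNorm x

theorem denseRange_incl (T : C0Semigroup 𝕜 X) (β : T.rho) : DenseRange (T.incl β) :=
  UniformSpace.Completion.denseRange_coe (α := T.PreExtrap β)

theorem opExtrap_add (T : C0Semigroup 𝕜 X) (β : T.rho) (s t : ℝ≥0) (y : T.Extrap β) :
    T.opExtrap β (s + t) y = T.opExtrap β s (T.opExtrap β t y) := by
  refine (T.denseRange_incl β).induction_on
    (p := fun y => T.opExtrap β (s + t) y = T.opExtrap β s (T.opExtrap β t y)) y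
    (isClosed_eq (by fun_prop) (by fun_prop)) fun x => ?_
  rw [opExtrap_incl, opExtrap_incl, opExtrap_incl, T.op_add]
  rfl

variable {T : C0Semigroup 𝕜 X} {M : ℝ≥0}

theorem norm_opExtrap_apply_le (hM : ∀ t, ‖T.op t‖ ≤ M) (β : T.rho) (t : ℝ≥0)
    (y : T.Extrap β) : ‖T.opExtrap β t y‖ ≤ M * ‖y‖ := by
  refine (T.denseRange_incl β).induction_on
    (p := fun y => ‖T.opExtrap β t y‖ ≤ M * ‖y‖) y
    (isClosed_le (by fun_prop) (by fun_prop)) fun x => ?_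
  rw [opExtrap_incl, norm_incl, norm_incl, resolvent_op]
  exact (T.op t).le_of_opNorm_le (hM t) _

/-- Strong continuity passes from the dense image of `X` by the uniform Lipschitz bound in the
second variable. Joint continuity is what makes the convolution integrand measurable. -/
theorem continuous_opExtrap_uncurry (hM : ∀ t, ‖T.op t‖ ≤ M) (β : T.rho) :
    Continuous fun p : ℝ≥0 × T.Extrap β => T.opExtrap β p.1 p.2 := by
  refine continuous_prod_of_dense_continuous_lipschitzWith' _ M (T.denseRange_incl β)
    (fun t => ?_) ?_
  · refine LipschitzWith.of_dist_le_mul fun y z => ?_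
    rw [dist_eq_norm, dist_eq_norm, ← map_sub]
    exact norm_opExtrap_apply_le hM β t _
  · rintro _ ⟨x, rfl⟩
    simp only [opExtrap_incl]
    exact (T.continuous_incl β).comp (T.continuous_orbit x)

variable {β : T.rho} {u v : ℝ → U}

/-- The response at time `t` to an input `u` acting on the whole past `(-∞, t)`. -/
noncomputable def forced (T : C0Semigroup 𝕜 X) (β : T.rho) (B : U →L[𝕜] T.Extrap β)
    (u : ℝ → U) (t : ℝ) : T.Extrap β :=
  ∫ s in Iio t, T.opExtrap β (t - s).toNNReal (B (u s))

theorem integrable_forced_integrand (hM : ∀ t, ‖T.op t‖ ≤ M) (B : U →L[𝕜] T.Extrap β)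
    (hu : Integrable u) (t : ℝ) :
    Integrable fun s => T.opExtrap β (t - s).toNNReal (B (u s)) := by
  have hB : Integrable fun s => B (u s) := B.integrable_comp hu
  refine Integrable.mono' (hB.norm.const_mul M) ?_ (ae_of_all _ fun s => ?_)
  · have ht : AEStronglyMeasurable (fun s : ℝ => (t - s).toNNReal) volume :=
      Continuous.aestronglyMeasurable (by fun_prop)
    have hp : AEStronglyMeasurable (fun s : ℝ => ((t - s).toNNReal, B (u s))) volume :=
      ht.prodMk hB.1
    have hc := continuous_opExtrap_uncurry hM β
    have hq := hc.comp_aestronglyMeasurable hp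
    exact hq
  · exact norm_opExtrap_apply_le hM β _ _

/-- This controls only the weak norm of `X₋₁`; it serves as the continuity input of the closed graph
argument. -/
theorem norm_forced_le (hM : ∀ t, ‖T.op t‖ ≤ M) (B : U →L[𝕜] T.Extrap β)
    (hu : Integrable u) (t : ℝ) :
    ‖T.forced β B u t‖ ≤ M * ‖B‖ * ∫ s in Iio t, ‖u s‖ := by
  rw [← integral_const_mul]
  refine norm_integral_le_of_norm_le (hu.norm.integrableOn.const_mul _)
    (ae_of_all _ fun s => ?_)
  refine (norm_opExtrap_apply_le hM β _ _).trans ?_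
  rw [mul_assoc]
  exact mul_le_mul_of_nonneg_left (B.le_opNorm _) M.2

theorem forced_add (hM : ∀ t, ‖T.op t‖ ≤ M) (B : U →L[𝕜] T.Extrap β)
    (hu : Integrable u) (hv : Integrable v) (t : ℝ) :
    T.forced β B (u + v) t = T.forced β B u t + T.forced β B v t := by
  rw [forced, forced, forced, ← integral_add (integrable_forced_integrand hM B hu t).integrableOn
    (integrable_forced_integrand hM B hv t).integrableOn]
  simp

theorem forced_smul (B : U →L[𝕜] T.Extrap β) (c : 𝕜) (u : ℝ → U) (t : ℝ) :
    T.forced β B (c • u) t = c • T.forced β B u t := by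
  rw [forced, forced, ← integral_smul]
  simp

theorem forced_congr (B : U →L[𝕜] T.Extrap β) {t : ℝ} (h : ∀ᵐ s, s < t → u s = v s) :
    T.forced β B u t = T.forced β B v t := by
  refine setIntegral_congr_ae measurableSet_Iio ?_
  filter_upwards [h] with s hs hst
  rw [hs hst]

theorem forced_shift (B : U →L[𝕜] T.Extrap β) (u : ℝ → U) (t h : ℝ) :
    T.forced β B (fun s => u (s + h)) t = T.forced β B u (t + h) := by
  have hi := (measurePreserving_add_right (volume : Measure ℝ) h).setIntegral_preimage_emb
    (measurableEmbedding_addRight h)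
    (fun s => T.opExtrap β (t + h - s).toNNReal (B (u s))) (Iio (t + h))
  have hs : (fun s : ℝ => s + h) ⁻¹' Iio (t + h) = Iio t := by
    ext s
    simp
  rw [hs] at hi
  rw [forced, forced, ← hi]
  simp

/-- The input before time `r` acts at time `t` only through the state it has produced at time `r`.
This identity drives both inductions over windows. -/
theorem forced_split (hM : ∀ t, ‖T.op t‖ ≤ M) (B : U →L[𝕜] T.Extrap β)
    (hu : Integrable u) {r t : ℝ} (hrt : r ≤ t) :
    T.forced β B u t = T.opExtrap β (t - r).toNNReal (T.forced β B u r) +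
      T.forced β B ((Ici r).indicator u) t := by
  have hi := integrable_forced_integrand hM B hu t
  have h1 : T.opExtrap β (t - r).toNNReal (T.forced β B u r) =
      ∫ s in Iio r, T.opExtrap β (t - s).toNNReal (B (u s)) := by
    rw [forced, ← ContinuousLinearMap.integral_comp_comm _
      (integrable_forced_integrand hM B hu r).integrableOn]
    refine setIntegral_congr_fun measurableSet_Iio fun s hs => ?_
    have hs' : s < r := hs
    rw [← opExtrap_add, ← Real.toNNReal_add (sub_nonneg.2 hrt) (sub_nonneg.2 hs'.le)]
    congr 3
    ring
  have h2 : T.forced β B ((Ici r).indicator u) t =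
      ∫ s in Ico r t, T.opExtrap β (t - s).toNNReal (B (u s)) := by
    have : Ico r t = Iio t ∩ Ici r := by
      ext s
      simp [and_comm]
    rw [this, ← setIntegral_indicator measurableSet_Ici, forced]
    congr 1
    ext s
    by_cases hs : s ∈ Ici r <;> simp [hs]
  rw [h1, h2, forced, ← setIntegral_union _ measurableSet_Ico hi.integrableOn hi.integrableOn,
    Iio_union_Ico_eq_Iio hrt]
  exact Set.disjoint_left.2 fun s h h' => not_le_of_gt h h'.1

/-- Extending the input by zero removes the initial time, so that translations and restarts become
identities for `forced`. -/
theorem mildSolution_eq (T : C0Semigroup 𝕜 X) (β : T.rho) (B : U →L[𝕜] T.Extrap β) (x₀ : X)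
    (u : ℝ → U) (t : ℝ≥0) :
    T.mildSolution β B x₀ u t =
      T.incl β (T.op t x₀) + T.forced β B ((Ioo (0 : ℝ) t).indicator u) t := by
  have h : ∀ s, T.opExtrap β ((t : ℝ) - s).toNNReal (B ((Ioo (0 : ℝ) t).indicator u s)) =
      (Ioo (0 : ℝ) t).indicator (fun s => T.opExtrap β ((t : ℝ) - s).toNNReal (B (u s))) s := by
    intro s
    by_cases hs : s ∈ Ioo (0 : ℝ) t <;> simp only [indicator_of_mem, indicator_of_notMem, hs,
      not_false_eq_true, map_zero]
  rw [mildSolution, forced, intervalIntegral.integral_of_le t.coe_nonneg, integral_Ioc_eq_integral_Ioo]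
  simp_rw [h]
  rw [setIntegral_indicator measurableSet_Ioo, inter_eq_right.2 Ioo_subset_Iio_self]

theorem mildSolution_zero_input (T : C0Semigroup 𝕜 X) (β : T.rho) (B : U →L[𝕜] T.Extrap β)
    (x₀ : X) (t : ℝ≥0) : T.mildSolution β B x₀ 0 t = T.incl β (T.op t x₀) := by
  simp [mildSolution]

theorem mildSolution_zero_state (T : C0Semigroup 𝕜 X) (β : T.rho) (B : U →L[𝕜] T.Extrap β)
    (u : ℝ → U) (t : ℝ≥0) :
    T.mildSolution β B 0 u t = T.forced β B ((Ioo (0 : ℝ) t).indicator u) t := by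
  simp [mildSolution_eq]

end

end C0Semigroup

/-! ### Admissibility -/

namespace C0Semigroup

section

variable {𝕜 X U : Type*} [RCLike 𝕜] [NormedAddCommGroup X] [NormedSpace 𝕜 X]
  [NormedAddCommGroup U] [NormedSpace 𝕜 U]
  {T : C0Semigroup 𝕜 X} {β : T.rho} {B : U →L[𝕜] T.Extrap β} {M : ℝ≥0}

theorem forced_eq_zero (B : U →L[𝕜] T.Extrap β) {u : ℝ → U} {t : ℝ} (h : ∀ s < t, u s = 0) :
    T.forced β B u t = 0 := by
  have h0 : T.forced β B u t = T.forced β B 0 t :=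
    forced_congr B (ae_of_all _ fun s hs => h s hs)
  rw [h0]
  simp [forced]

/-- `L¹`-admissibility at time one is automatically bounded, by the closed graph theorem. -/
theorem exists_bound_forced_one [CompleteSpace X] [CompleteSpace U] (hM : ∀ t, ‖T.op t‖ ≤ M)
    (h : ∀ u : ℝ → U, IntegrableOn u (Ioo 0 1) →
      ∃ x, T.incl β x = T.forced β B ((Ioo (0 : ℝ) 1).indicator u) 1) :
    ∃ C : ℝ≥0, ∀ u : ℝ → U, IntegrableOn u (Ioo 0 1) →
      ∃ x, T.incl β x = T.forced β B ((Ioo (0 : ℝ) 1).indicator u) 1 ∧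
        ‖x‖ ≤ C * ∫ s in Ioo (0 : ℝ) 1, ‖u s‖ := by
  have hcongr : ∀ u v : ℝ → U, u =ᵐ[volume.restrict (Ioo (0 : ℝ) 1)] v →
      T.forced β B ((Ioo (0 : ℝ) 1).indicator u) 1 =
        T.forced β B ((Ioo (0 : ℝ) 1).indicator v) 1 := by
    intro u v huv
    refine forced_congr B ?_
    filter_upwards [(ae_restrict_iff' measurableSet_Ioo).1 huv] with s hs _
    by_cases hs' : s ∈ Ioo (0 : ℝ) 1
    · simp [hs', hs hs']
    · simp [hs']
  have hint : ∀ f : Lp U 1 (volume.restrict (Ioo (0 : ℝ) 1)),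
      Integrable ((Ioo (0 : ℝ) 1).indicator f) := fun f =>
    (integrable_indicator_iff measurableSet_Ioo).2 (L1.integrable_coeFn f)
  -- Injectivity of `incl` makes the chosen state unique, hence linear in the input.
  choose g hg using fun f : Lp U 1 (volume.restrict (Ioo (0 : ℝ) 1)) =>
    h f (L1.integrable_coeFn f)
  let G : Lp U 1 (volume.restrict (Ioo (0 : ℝ) 1)) →ₗ[𝕜] X :=
    { toFun := g
      map_add' := fun f₁ f₂ => by
        apply T.incl_injective β
        rw [map_add, hg, hg, hg, ← forced_add hM B (hint f₁) (hint f₂), ← indicator_add']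
        exact hcongr _ _ (Lp.coeFn_add f₁ f₂)
      map_smul' := fun c f => by
        apply T.incl_injective β
        rw [map_smul, hg, RingHom.id_apply, hg, ← forced_smul]
        refine (hcongr _ _ (Lp.coeFn_smul c f)).trans (congrArg (T.forced β B · 1) ?_)
        exact indicator_const_smul _ c _ }
  have hbound : ∀ f, ‖T.incl β (G f)‖ ≤ (M * ‖B‖) * ‖f‖ := by
    intro f
    change ‖T.incl β (g f)‖ ≤ _
    rw [hg, L1.norm_eq_integral_norm]
    refine (norm_forced_le hM B (hint f) 1).trans_eq ?_
    simp_rw [norm_indicator_eq_indicator_norm]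
    rw [setIntegral_indicator measurableSet_Ioo, inter_eq_right.2 Ioo_subset_Iio_self]
  have hcont : Continuous fun f => T.incl β (G f) :=
    AddMonoidHomClass.continuous_of_bound ((T.incl β).comp G) _ hbound
  -- The graph is closed because both limits can be compared in `X₋₁`, where the response is already
  -- continuous.
  have hG : Continuous G := by
    refine G.continuous_of_seq_closed_graph fun f f₀ x hf hx => T.incl_injective β ?_
    exact tendsto_nhds_unique (((T.continuous_incl β).tendsto x).comp hx)
      ((hcont.tendsto f₀).comp hf)
  let G' : Lp U 1 (volume.restrict (Ioo (0 : ℝ) 1)) →L[𝕜] X := ⟨G, hG⟩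
  refine ⟨‖G'‖₊, fun u hu => ⟨g hu.toL1, ?_, ?_⟩⟩
  · rw [hg]
    exact hcongr _ _ hu.coeFn_toL1
  · refine (G'.le_opNorm hu.toL1).trans_eq ?_
    rw [L1.norm_eq_integral_norm]
    congr 1
    refine integral_congr_ae ?_
    filter_upwards [hu.coeFn_toL1] with s hs
    rw [hs]

theorem exists_forced_window {C : ℝ≥0}
    (h : ∀ u : ℝ → U, IntegrableOn u (Ioo 0 1) →
      ∃ x, T.incl β x = T.forced β B ((Ioo (0 : ℝ) 1).indicator u) 1 ∧
        ‖x‖ ≤ C * ∫ s in Ioo (0 : ℝ) 1, ‖u s‖)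
    {u : ℝ → U} (hu : Integrable u) (t : ℝ) :
    ∃ x, T.incl β x = T.forced β B ((Ici (t - 1)).indicator u) t ∧
      ‖x‖ ≤ C * ∫ s in Ico (t - 1) t, ‖u s‖ := by
  obtain ⟨x, hx, hxC⟩ := h (fun s => u (s + (t - 1))) (hu.comp_add_right (t - 1)).integrableOn
  refine ⟨x, ?_, hxC.trans_eq ?_⟩
  · have h1 := forced_shift B ((Ici (t - 1)).indicator u) 1 (t - 1)
    rw [add_sub_cancel] at h1
    rw [hx, ← h1]
    refine forced_congr B ?_
    -- The translated window is closed at its left end while `Ioo 0 1` is open, so the point `0` is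
    -- discarded.
    filter_upwards [compl_mem_ae_iff.2 (measure_singleton (0 : ℝ))] with s hs hs1
    have hs0 : s ≠ 0 := hs
    rcases lt_or_gt_of_ne hs0 with h0 | h0
    · simp [indicator, h0.not_ge, h0.not_gt]
    · simp [indicator, h0.le, h0, hs1]
  · have hi := (measurePreserving_add_right (volume : Measure ℝ) (t - 1)).setIntegral_preimage_emb
      (measurableEmbedding_addRight (t - 1)) (fun s => ‖u s‖) (Ioo (t - 1) t)
    have hs : (fun s : ℝ => s + (t - 1)) ⁻¹' Ioo (t - 1) t = Ioo 0 1 := by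
      ext s
      simp only [mem_preimage, mem_Ioo]
      constructor <;> rintro ⟨h1, h2⟩ <;> constructor <;> linarith
    rw [hs] at hi
    rw [hi, integral_Ico_eq_integral_Ioo]

theorem norm_op_op_le (hM : ∀ t, ‖T.op t‖ ≤ M) (t : ℝ≥0) (x : X) : ‖T.op t x‖ ≤ M * ‖x‖ :=
  (T.op t).le_of_opNorm_le (hM t) x

/-- For a bounded semigroup, the `L¹`-admissibility bound at time one is uniform in time. -/
theorem exists_forced_bound (hM : ∀ t, ‖T.op t‖ ≤ M) {C : ℝ≥0}
    (h : ∀ u : ℝ → U, IntegrableOn u (Ioo 0 1) →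
      ∃ x, T.incl β x = T.forced β B ((Ioo (0 : ℝ) 1).indicator u) 1 ∧
        ‖x‖ ≤ C * ∫ s in Ioo (0 : ℝ) 1, ‖u s‖)
    {u : ℝ → U} (hu : Integrable u) (n : ℕ) :
    ∀ t : ℝ, (∀ s < t - n, u s = 0) → ∃ x, T.incl β x = T.forced β B u t ∧
      ∀ r, ‖T.op r x‖ ≤ M * C * ∫ s in Iio t, ‖u s‖ := by
  induction n with
  | zero =>
    intro t ht
    refine ⟨0, ?_, fun r => ?_⟩
    · rw [map_zero, forced_eq_zero B fun s hs => ht s (by simpa using hs)]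
    · rw [map_zero, norm_zero]
      positivity
  | succ n ih =>
    intro t ht
    obtain ⟨x, hx, hxC⟩ := ih (t - 1) fun s hs => ht s (by push_cast; linarith)
    obtain ⟨y, hy, hyC⟩ := exists_forced_window h hu t
    refine ⟨T.op (t - (t - 1)).toNNReal x + y, ?_, fun r => ?_⟩
    · rw [map_add, ← opExtrap_incl, hx, hy, ← forced_split hM B hu (by linarith)]
    · have hun : ∫ s in Iio t, ‖u s‖ = (∫ s in Iio (t - 1), ‖u s‖) + ∫ s in Ico (t - 1) t, ‖u s‖ := by
        rw [← setIntegral_union _ measurableSet_Ico hu.norm.integrableOn hu.norm.integrableOn,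
          Iio_union_Ico_eq_Iio (by linarith)]
        exact Set.disjoint_left.2 fun s h h' => not_le_of_gt h h'.1
      -- Bounding all `T(r)x` rather than `x` alone lets the induction hypothesis absorb the extra
      -- unit of time: each window costs `M` once, and powers of `M` never build up.
      have h1 := hxC (r + (t - (t - 1)).toNNReal)
      rw [T.op_add] at h1
      have h2 := (norm_op_op_le hM r y).trans (mul_le_mul_of_nonneg_left hyC M.2)
      rw [map_add, hun, mul_add]
      refine (norm_add_le _ _).trans (add_le_add h1 (h2.trans_eq ?_))
      rw [← mul_assoc]

/-- If `T(τ)` is a contraction with factor `1/2`, the forced response is controlled by the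
`L¹`-norms of the input over windows of length `τ`. -/
theorem exists_forced_le_of_window (hM : ∀ t, ‖T.op t‖ ≤ M) {C : ℝ}
    (h : ∀ (u : ℝ → U) (a t : ℝ), Integrable u → (∀ s < a, u s = 0) →
      ∃ x, T.incl β x = T.forced β B u t ∧ ‖x‖ ≤ C * ∫ s in Iio t, ‖u s‖)
    (hC : 0 ≤ C) {τ : ℝ≥0} (hτ : ∀ x, ‖T.op τ x‖ ≤ 2⁻¹ * ‖x‖)
    {u : ℝ → U} (hu : Integrable u) {K : ℝ} (hK : ∀ a : ℝ, ∫ s in Ico a (a + τ), ‖u s‖ ≤ K) (n : ℕ) :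
    ∀ t : ℝ, (∀ s < t - n * τ, u s = 0) → ∃ x, T.incl β x = T.forced β B u t ∧
      ‖x‖ ≤ 2 * C * K := by
  have hK0 : 0 ≤ K := (integral_nonneg fun s => norm_nonneg (u s)).trans (hK 0)
  induction n with
  | zero =>
    intro t ht
    refine ⟨0, ?_, ?_⟩
    · rw [map_zero, forced_eq_zero B fun s hs => ht s (by simpa using hs)]
    · rw [norm_zero]
      positivity
  | succ n ih =>
    intro t ht
    obtain ⟨x, hx, hxC⟩ := ih (t - τ) fun s hs => ht s (by push_cast; linarith)
    obtain ⟨y, hy, hyC⟩ := h ((Ici (t - τ)).indicator u) (t - τ) t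
      (hu.indicator measurableSet_Ici) fun s hs =>
        indicator_of_notMem (s := Ici (t - τ)) (not_le.2 hs) u
    have hle : t - τ ≤ t := by linarith [τ.coe_nonneg]
    have hτ' : (t - (t - τ)).toNNReal = τ := by simp
    refine ⟨T.op τ x + y, ?_, ?_⟩
    · rw [map_add, ← opExtrap_incl, hx, hy, forced_split hM B hu hle, hτ']
    · have hw : ∫ s in Iio t, ‖(Ici (t - τ)).indicator u s‖ ≤ K := by
        simp_rw [norm_indicator_eq_indicator_norm]
        rw [setIntegral_indicator measurableSet_Ici, inter_comm, Ici_inter_Iio]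
        simpa using hK (t - τ)
      -- The constant `2CK` is the fixed point of the recursion: half of it survives from the past,
      -- and the last window adds at most `CK`.
      have h1 := hτ x
      have h2 := mul_le_mul_of_nonneg_left hw hC
      have h3 := norm_add_le (T.op τ x) y
      linarith

end

end C0Semigroup

/-! ### Stability of the semigroup and `L¹`-stability -/

theorem isClassKInfty_mul (c : ℝ≥0) (hc : 0 < c) : IsClassKInfty fun r => c * r where
  map_zero := mul_zero c
  continuous := by fun_prop
  strictMono := fun _ _ h => mul_lt_mul_of_pos_left h hc
  tendsto := tendsto_id.const_mul_atTop hc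

theorem isClassK_id : IsClassK id :=
  ⟨rfl, continuous_id, strictMono_id⟩

theorem coe_norm_inputL1 {U : Type*} [NormedAddCommGroup U] {u : ℝ → U}
    {t : ℝ≥0} (hu : u ∈ (inputL1 U).carrier t) :
    (((inputL1 U).norm t u : ℝ≥0) : ℝ) = ∫ s in Iio (t : ℝ), ‖(Ioo (0 : ℝ) t).indicator u s‖ := by
  have hu' : MemLp u 1 (intervalMeasure t) := hu
  simp_rw [norm_indicator_eq_indicator_norm]
  rw [setIntegral_indicator measurableSet_Ioo, inter_eq_right.2 Ioo_subset_Iio_self]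
  refine Eq.trans ?_ (integral_norm_eq_lintegral_enorm hu'.1).symm
  change (eLpNorm u 1 (intervalMeasure t)).toReal = _
  rw [eLpNorm_one_eq_lintegral_enorm]

namespace C0Semigroup

section

variable {𝕜 X U : Type*} [RCLike 𝕜] [NormedAddCommGroup X] [NormedSpace 𝕜 X]
  [NormedAddCommGroup U] [NormedSpace 𝕜 U]
  {T : C0Semigroup 𝕜 X} {β : T.rho} {B : U →L[𝕜] T.Extrap β}

/-- A decay bound of class `𝒦ℒ` for the semigroup. -/
def IsStableWith (T : C0Semigroup 𝕜 X) (b : ℝ≥0 → ℝ≥0 → ℝ≥0) : Prop :=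
  IsClassKL b ∧ ∀ (t : ℝ≥0) (x : X), ‖T.op t x‖₊ ≤ b ‖x‖₊ t

/-- At time one the state lies in `X` for all inputs of class `L¹`. -/
def IsL1Admissible (T : C0Semigroup 𝕜 X) (β : T.rho) (B : U →L[𝕜] T.Extrap β) : Prop :=
  ∀ u : ℝ → U, IntegrableOn u (Ioo 0 1) →
    ∃ x, T.incl β x = T.forced β B ((Ioo (0 : ℝ) 1).indicator u) 1

/-- By linearity unit vectors suffice, so the possibly nonlinear dependence of `b` on its first
argument disappears. -/
theorem IsStableWith.norm_op_le {b : ℝ≥0 → ℝ≥0 → ℝ≥0} (h : T.IsStableWith b) (t : ℝ≥0) :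
    ‖T.op t‖ ≤ b 1 t := by
  refine ContinuousLinearMap.opNorm_le_of_unit_norm (b 1 t).2 fun x hx => ?_
  have hx' : ‖x‖₊ = 1 := NNReal.eq hx
  have := h.2 t x
  rw [hx'] at this
  exact_mod_cast this

theorem IsStableWith.norm_op_le_zero {b : ℝ≥0 → ℝ≥0 → ℝ≥0} (h : T.IsStableWith b) (t : ℝ≥0) :
    ‖T.op t‖ ≤ b 1 0 :=
  (h.norm_op_le t).trans
    (NNReal.coe_le_coe.2 ((h.1.classL 1 one_pos).strictAnti.antitone zero_le))

theorem IsStableWith.exists_half {b : ℝ≥0 → ℝ≥0 → ℝ≥0} (h : T.IsStableWith b) :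
    ∃ τ : ℝ≥0, 0 < τ ∧ ∀ x, ‖T.op τ x‖ ≤ 2⁻¹ * ‖x‖ := by
  have h1 : ∀ᶠ t in atTop, b 1 t < 2⁻¹ :=
    (h.1.classL 1 one_pos).tendsto.eventually_lt_const (by positivity)
  obtain ⟨τ, h2, h3⟩ := (h1.and (eventually_gt_atTop 0)).exists
  refine ⟨τ, h3, fun x => (T.op τ).le_of_opNorm_le ((h.norm_op_le τ).trans ?_) x⟩
  exact_mod_cast h2.le

theorem IsL1Admissible.exists_bound [CompleteSpace X] [CompleteSpace U]
    (hA : T.IsL1Admissible β B) {b : ℝ≥0 → ℝ≥0 → ℝ≥0} (hb : T.IsStableWith b) :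
    ∃ C : ℝ≥0, ∀ (u : ℝ → U) (a t : ℝ), Integrable u → (∀ s < a, u s = 0) →
      ∃ x, T.incl β x = T.forced β B u t ∧ ‖x‖ ≤ C * ∫ s in Iio t, ‖u s‖ := by
  obtain ⟨C, hC⟩ := exists_bound_forced_one hb.norm_op_le_zero hA
  refine ⟨b 1 0 * C, fun u a t hu ha => ?_⟩
  obtain ⟨n, hn⟩ := exists_nat_ge (t - a)
  obtain ⟨x, hx, hxC⟩ := exists_forced_bound hb.norm_op_le_zero hC hu n t
    fun s hs => ha s (by linarith)
  refine ⟨x, hx, ?_⟩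
  have := hxC 0
  rwa [T.op_zero] at this

theorem IsStableWith.isISS_L1 [CompleteSpace X] [CompleteSpace U] {b : ℝ≥0 → ℝ≥0 → ℝ≥0}
    (hb : T.IsStableWith b) (hA : T.IsL1Admissible β B) : IsISS T β B (inputL1 U) := by
  obtain ⟨C, hC⟩ := hA.exists_bound hb
  -- `C` may vanish; `C + 1` keeps the gain strictly increasing and unbounded.
  refine ⟨b, fun r => (C + 1) * r, hb.1, isClassKInfty_mul _ (by positivity),
    fun t x₀ u hu => ?_⟩
  have hi : Integrable ((Ioo (0 : ℝ) t).indicator u) :=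
    (integrable_indicator_iff measurableSet_Ioo).2 (memLp_one_iff_integrable.1 hu)
  obtain ⟨y, hy, hyC⟩ := hC _ 0 t hi fun s hs =>
    indicator_of_notMem (fun h : s ∈ Ioo (0 : ℝ) t => hs.not_gt h.1) u
  rw [← coe_norm_inputL1 hu] at hyC
  have hyC' : ‖y‖₊ ≤ C * (inputL1 U).norm t u := by exact_mod_cast hyC
  refine ⟨T.op t x₀ + y, by rw [map_add, hy, mildSolution_eq], ?_⟩
  refine (nnnorm_add_le _ _).trans (add_le_add (hb.2 t x₀) (hyC'.trans ?_))
  exact mul_le_mul_left le_self_add _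

theorem _root_.IsISS.isIISS_L1 (h : IsISS T β B (inputL1 U)) : IsIISS T β B (inputL1 U) := by
  obtain ⟨b, μ, hb, hμ, h⟩ := h
  refine ⟨b, μ, id, hb, hμ, isClassK_id, fun t x₀ u hu => ?_⟩
  obtain ⟨x, hx, hxb⟩ := h t x₀ u hu
  refine ⟨x, hx, fun _ => ?_⟩
  have hn : (inputL1 U).norm t u =
      (∫⁻ s, ((id ‖u s‖₊ : ℝ≥0) : ℝ≥0∞) ∂(intervalMeasure t)).toNNReal := by
    change (eLpNorm u 1 (intervalMeasure t)).toNNReal = _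
    rw [eLpNorm_one_eq_lintegral_enorm]
    rfl
  rwa [← hn]

theorem _root_.IsISS.exists_isStableWith {Z : InputSpaces U} (h : IsISS T β B Z)
    (h0 : ∀ t, (0 : ℝ → U) ∈ Z.carrier t ∧ Z.norm t 0 = 0) : ∃ b, T.IsStableWith b := by
  obtain ⟨b, μ, hb, hμ, h⟩ := h
  refine ⟨b, hb, fun t x₀ => ?_⟩
  obtain ⟨x, hx, hxb⟩ := h t x₀ 0 (h0 t).1
  rw [mildSolution_zero_input] at hx
  rwa [T.incl_injective β hx, (h0 t).2, hμ.map_zero, add_zero] at hxb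

theorem _root_.IsIISS.exists_isStableWith (h : IsIISS T β B (inputL1 U)) :
    ∃ b, T.IsStableWith b := by
  obtain ⟨b, θ, μ, hb, hθ, hμ, h⟩ := h
  refine ⟨b, hb, fun t x₀ => ?_⟩
  obtain ⟨x, hx, hxb⟩ := h t x₀ 0 (MemLp.zero' : MemLp (fun _ => (0 : U)) 1 (intervalMeasure t))
  rw [mildSolution_zero_input] at hx
  simpa [T.incl_injective β hx, hθ.map_zero, hμ.map_zero] using hxb

/-- The estimate may be void for this `u`, but the state lies in `X` regardless. -/
theorem _root_.IsIISS.isL1Admissible (h : IsIISS T β B (inputL1 U)) : T.IsL1Admissible β B := by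
  obtain ⟨b, θ, μ, hb, hθ, hμ, h⟩ := h
  intro u hu
  obtain ⟨x, hx, -⟩ := h 1 0 u (memLp_one_iff_integrable.2
    (by simpa only [intervalMeasure, NNReal.coe_one, IntegrableOn] using hu))
  exact ⟨x, by simpa [mildSolution_zero_state] using hx⟩

end

end C0Semigroup

/-! ### Young functions -/

namespace IsYoungFunction

variable {Φ : ℝ≥0 → ℝ≥0}

theorem map_zero (h : IsYoungFunction Φ) : Φ 0 = 0 := by
  obtain ⟨φ, -, -, -, -, -, h⟩ := h
  exact NNReal.eq (by simp [h 0])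

theorem monotone (h : IsYoungFunction Φ) : Monotone Φ := by
  obtain ⟨φ, -, hm, -, -, -, h⟩ := h
  intro s t hst
  have hφ : Monotone fun s : ℝ => (φ s.toNNReal : ℝ) :=
    fun x y hxy => NNReal.coe_le_coe.2 (hm (Real.toNNReal_mono hxy))
  rw [← NNReal.coe_le_coe, h, h]
  exact intervalIntegral.integral_mono_interval le_rfl s.coe_nonneg (NNReal.coe_le_coe.2 hst)
    (ae_of_all _ fun x => NNReal.coe_nonneg _) hφ.intervalIntegrable

/-- A Young function dominates the identity up to an additive constant. -/
theorem exists_le_add (h : IsYoungFunction Φ) : ∃ s₀ : ℝ≥0, ∀ s, s ≤ Φ s + s₀ := by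
  obtain ⟨φ, -, hm, -, -, ht, h⟩ := h
  have hφ : Monotone fun s : ℝ => (φ s.toNNReal : ℝ) :=
    fun x y hxy => NNReal.coe_le_coe.2 (hm (Real.toNNReal_mono hxy))
  obtain ⟨s₀, hs₀⟩ := (ht.eventually_ge_atTop 1).exists
  refine ⟨s₀, fun s => ?_⟩
  rcases le_total s s₀ with hs | hs
  · exact hs.trans le_add_self
  · rw [← NNReal.coe_le_coe, NNReal.coe_add, h,
      ← intervalIntegral.integral_add_adjacent_intervals (b := (s₀ : ℝ)) hφ.intervalIntegrable
        hφ.intervalIntegrable]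
    have h1 : (0 : ℝ) ≤ ∫ x in (0 : ℝ)..s₀, (φ x.toNNReal : ℝ) :=
      intervalIntegral.integral_nonneg s₀.coe_nonneg fun x _ => NNReal.coe_nonneg _
    have h2 : ∫ x in (s₀ : ℝ)..s, (1 : ℝ) ≤ ∫ x in (s₀ : ℝ)..s, (φ x.toNNReal : ℝ) := by
      refine intervalIntegral.integral_mono_on (NNReal.coe_le_coe.2 hs) (by simp)
        hφ.intervalIntegrable fun x hx => ?_
      have : s₀ ≤ x.toNNReal := NNReal.le_toNNReal_of_coe_le hx.1
      exact_mod_cast hs₀.trans (hm this)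
    rw [intervalIntegral.integral_const, smul_eq_mul, mul_one] at h2
    linarith

/-- This is convexity together with `Φ 0 = 0`, proved by substituting in the integral and using that
`φ` is monotone. -/
theorem map_mul_le (h : IsYoungFunction Φ) {c : ℝ≥0} (hc : c ≤ 1) (s : ℝ≥0) :
    Φ (c * s) ≤ c * Φ s := by
  obtain ⟨φ, -, hm, -, -, -, h⟩ := h
  have hφ : Monotone fun s : ℝ => (φ s.toNNReal : ℝ) :=
    fun x y hxy => NNReal.coe_le_coe.2 (hm (Real.toNNReal_mono hxy))
  have hφc : Monotone fun s : ℝ => (φ ((c : ℝ) * s).toNNReal : ℝ) :=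
    fun x y hxy => hφ (mul_le_mul_of_nonneg_left hxy c.coe_nonneg)
  have hmul := intervalIntegral.mul_integral_comp_mul_left (a := (0 : ℝ)) (b := (s : ℝ))
    (f := fun s : ℝ => (φ s.toNNReal : ℝ)) (c : ℝ)
  rw [mul_zero] at hmul
  rw [← NNReal.coe_le_coe, NNReal.coe_mul, h, h, NNReal.coe_mul, ← hmul]
  refine mul_le_mul_of_nonneg_left ?_ c.coe_nonneg
  refine intervalIntegral.integral_mono_on s.coe_nonneg hφc.intervalIntegrable
    hφ.intervalIntegrable fun x hx => hφ ?_
  exact mul_le_of_le_one_left hx.1 hc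

end IsYoungFunction

/-! ### Orlicz inputs: modular estimates and local integrability. -/

section

variable {U : Type*} [NormedAddCommGroup U] {Φ : ℝ≥0 → ℝ≥0} {t : ℝ≥0} {u : ℝ → U}

theorem MemOrlicz.exists_lintegral_le_one (hΦ : IsYoungFunction Φ) (hu : MemOrlicz Φ t u) :
    ∃ k : ℝ≥0, 0 < k ∧ ∫⁻ s, (Φ (k⁻¹ * ‖u s‖₊) : ℝ≥0∞) ∂(intervalMeasure t) ≤ 1 := by
  obtain ⟨-, k, hk, hI⟩ := hu
  lift ∫⁻ s, (Φ (k⁻¹ * ‖u s‖₊) : ℝ≥0∞) ∂(intervalMeasure t) to ℝ≥0 using hI.ne with I hI'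
  have hm : (0 : ℝ≥0) < max 1 I := lt_max_of_lt_left one_pos
  -- Enlarging `k` by `max 1 I` divides the modular by at least that factor, by convexity.
  refine ⟨max 1 I * k, mul_pos hm hk, ?_⟩
  have hle : ∀ s, (Φ ((max 1 I * k)⁻¹ * ‖u s‖₊) : ℝ≥0∞) ≤
      ((max 1 I)⁻¹ : ℝ≥0) * (Φ (k⁻¹ * ‖u s‖₊) : ℝ≥0∞) := fun s => by
    rw [mul_inv, mul_assoc]
    exact_mod_cast hΦ.map_mul_le (inv_le_one_of_one_le₀ (le_max_left _ _)) _
  refine (lintegral_mono hle).trans ?_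
  rw [lintegral_const_mul' _ _ ENNReal.coe_ne_top, ← hI']
  norm_cast
  rw [inv_mul_le_iff₀ hm, mul_one]
  exact le_max_right _ _

/-- Apply `s ≤ Φ s + s₀` to `‖u‖ / k`. The additive error is paid only on `S`, so over a window the
bound does not involve `t`. -/
theorem lintegral_enorm_indicator_le {s₀ : ℝ≥0}
    (hs₀ : ∀ s, s ≤ Φ s + s₀) {k : ℝ≥0} (hk : 0 < k) (S : Set ℝ) :
    ∫⁻ s in S, ‖(Ioo (0 : ℝ) t).indicator u s‖ₑ ≤
      k * ((∫⁻ s, (Φ (k⁻¹ * ‖u s‖₊) : ℝ≥0∞) ∂(intervalMeasure t)) + s₀ * volume S) := by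
  have hle : ∀ s, ‖(Ioo (0 : ℝ) t).indicator u s‖ₑ ≤
      k * ((Ioo (0 : ℝ) t).indicator (fun s => (Φ (k⁻¹ * ‖u s‖₊) : ℝ≥0∞)) s + s₀) := by
    intro s
    by_cases hs : s ∈ Ioo (0 : ℝ) t
    · rw [indicator_of_mem hs, indicator_of_mem hs, enorm_eq_nnnorm]
      have h1 := mul_le_mul_right (hs₀ (k⁻¹ * ‖u s‖₊)) k
      rw [mul_inv_cancel_left₀ hk.ne'] at h1
      exact_mod_cast h1
    · simp [indicator_of_notMem hs]
  refine (lintegral_mono hle).trans ?_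
  rw [lintegral_const_mul' _ _ ENNReal.coe_ne_top]
  gcongr
  rw [lintegral_add_right _ measurable_const, setLIntegral_const]
  have h := setLIntegral_le_lintegral (μ := volume) S
    ((Ioo (0 : ℝ) t).indicator (fun s => (Φ (k⁻¹ * ‖u s‖₊) : ℝ≥0∞)))
  exact add_le_add (h.trans_eq (lintegral_indicator measurableSet_Ioo _)) le_rfl

theorem MemOrlicz.integrable_indicator (hΦ : IsYoungFunction Φ) (hu : MemOrlicz Φ t u) :
    Integrable ((Ioo (0 : ℝ) t).indicator u) := by
  obtain ⟨s₀, hs₀⟩ := hΦ.exists_le_add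
  obtain ⟨k, hk, hI⟩ := hu.2
  refine (integrable_indicator_iff measurableSet_Ioo).2 ⟨hu.1, ?_⟩
  have h := lintegral_enorm_indicator_le (t := t) (u := u) hs₀ hk (Ioo (0 : ℝ) t)
  rw [setLIntegral_congr_fun (g := fun s => ‖u s‖ₑ) measurableSet_Ioo fun s hs => by
    simp only [indicator_of_mem hs]] at h
  refine h.trans_lt (ENNReal.mul_lt_top ENNReal.coe_lt_top (ENNReal.add_lt_top.2 ⟨hI, ?_⟩))
  exact ENNReal.mul_lt_top ENNReal.coe_lt_top (by simp)

theorem zero_mem_inputE (hΦ : IsYoungFunction Φ) (t : ℝ≥0) :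
    (0 : ℝ → U) ∈ (inputE U Φ).carrier t ∧ (inputE U Φ).norm t 0 = 0 := by
  have h0 : luxemburgNorm Φ t (0 : ℝ → U) = 0 := by
    refine le_antisymm (le_of_forall_pos_le_add fun ε hε => ?_) zero_le
    rw [zero_add]
    exact csInf_le (OrderBot.bddBelow _) ⟨hε, by simp [hΦ.map_zero]⟩
  refine ⟨⟨⟨aestronglyMeasurable_const, 1, one_pos, by simp [hΦ.map_zero]⟩, fun ε hε => ⟨0, ?_, ?_⟩⟩,
    h0⟩
  · exact (MemLp.zero' : MemLp (fun _ => (0 : U)) ∞ (intervalMeasure t))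
  · rwa [sub_zero, h0]

end

/-! ### Orlicz stability from decay and admissibility. -/

namespace C0Semigroup

section

variable {𝕜 X U : Type*} [RCLike 𝕜] [NormedAddCommGroup X] [NormedSpace 𝕜 X]
  [NormedAddCommGroup U] [NormedSpace 𝕜 U]
  {T : C0Semigroup 𝕜 X} {β : T.rho} {B : U →L[𝕜] T.Extrap β}

theorem IsStableWith.isISS_E [CompleteSpace X] [CompleteSpace U] {b : ℝ≥0 → ℝ≥0 → ℝ≥0}
    (hb : T.IsStableWith b) (hA : T.IsL1Admissible β B) {Φ : ℝ≥0 → ℝ≥0}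
    (hΦ : IsYoungFunction Φ) : IsISS T β B (inputE U Φ) := by
  obtain ⟨C, hC⟩ := hA.exists_bound hb
  obtain ⟨τ, hτ0, hτ⟩ := hb.exists_half
  obtain ⟨s₀, hs₀⟩ := hΦ.exists_le_add
  -- A window of length `τ` has `L¹` norm at most `k(1 + s₀τ)`, and the window lemma multiplies this
  -- by `2C`; the final `1` ensures positivity.
  let c : ℝ≥0 := 2 * C * (1 + s₀ * τ) + 1
  have hc : 0 < c := by positivity
  refine ⟨b, fun r => c * r, hb.1, isClassKInfty_mul c hc, fun t x₀ u hu => ?_⟩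
  have hi := hu.1.integrable_indicator hΦ
  obtain ⟨n, hn⟩ := exists_nat_ge ((t : ℝ) / τ)
  have key : ∀ k : ℝ≥0, 0 < k ∧ ∫⁻ s, (Φ (k⁻¹ * ‖u s‖₊) : ℝ≥0∞) ∂(intervalMeasure t) ≤ 1 →
      ∃ y, T.incl β y = T.forced β B ((Ioo (0 : ℝ) t).indicator u) t ∧ ‖y‖₊ ≤ c * k := by
    rintro k ⟨hk, hI⟩
    have hK : ∀ a : ℝ, ∫ s in Ico a (a + τ), ‖(Ioo (0 : ℝ) t).indicator u s‖ ≤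
        k * (1 + s₀ * τ) := fun a => by
      rw [integral_norm_eq_lintegral_enorm hi.1.restrict]
      refine ENNReal.toReal_le_of_le_ofReal (by positivity) ?_
      refine (lintegral_enorm_indicator_le hs₀ hk _).trans ?_
      rw [Real.volume_Ico, add_sub_cancel_left, ENNReal.ofReal_coe_nnreal]
      have : ENNReal.ofReal ((k : ℝ) * (1 + s₀ * τ)) = (k : ℝ≥0∞) * (1 + s₀ * τ) := by
        rw [← ENNReal.ofReal_coe_nnreal, ← ENNReal.ofReal_coe_nnreal (p := s₀),
          ← ENNReal.ofReal_coe_nnreal (p := τ), ← ENNReal.ofReal_mul s₀.coe_nonneg,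
          ← ENNReal.ofReal_one, ← ENNReal.ofReal_add zero_le_one (by positivity),
          ← ENNReal.ofReal_mul k.coe_nonneg]
      rw [this]
      gcongr
    obtain ⟨y, hy, hyK⟩ := exists_forced_le_of_window hb.norm_op_le_zero hC C.coe_nonneg hτ hi hK n t
      fun s hs => by
        refine indicator_of_notMem (fun h : s ∈ Ioo (0 : ℝ) t => ?_) u
        have := (div_le_iff₀ (NNReal.coe_pos.2 hτ0)).1 hn
        linarith [h.1]
    refine ⟨y, hy, ?_⟩
    rw [← NNReal.coe_le_coe]
    refine hyK.trans ?_
    simp only [c, NNReal.coe_mul, NNReal.coe_add, NNReal.coe_one, NNReal.coe_ofNat]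
    have := k.coe_nonneg
    nlinarith
  obtain ⟨k₀, hk₀⟩ := hu.1.exists_lintegral_le_one hΦ
  obtain ⟨y, hy, -⟩ := key k₀ hk₀
  have hyc : ‖y‖₊ ≤ c * luxemburgNorm Φ t u := by
    rw [← div_le_iff₀' hc]
    -- The state is the same for every admissible `k`, so the bound passes to the infimum whether or
    -- not it is attained.
    refine le_csInf ⟨k₀, hk₀⟩ fun k hk => ?_
    obtain ⟨z, hz, hzk⟩ := key k hk
    rw [T.incl_injective β (hz.trans hy.symm)] at hzk
    rwa [div_le_iff₀' hc]
  refine ⟨T.op t x₀ + y, by rw [map_add, hy, mildSolution_eq], ?_⟩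
  exact (nnnorm_add_le _ _).trans (add_le_add (hb.2 t x₀) hyc)

end

end C0Semigroup

/-! ### A Young function adapted to an integrable function -/

/-- A sum of truncated linear functions with slopes `1 / N j`. -/
noncomputable def truncSum (N : ℕ → ℝ≥0) (s : ℝ≥0) : ℝ≥0 :=
  ∑' j, min 1 (s / N j)

section

variable {N : ℕ → ℝ≥0}

/-- The growth of `N` gives a geometric majorant, hence convergence of the series and the linear
bound `truncSum N s ≤ 2s`. -/
theorem div_le_mul_geometric (hN : ∀ j, 2 ^ j ≤ N j) (s : ℝ≥0) (j : ℕ) :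
    s / N j ≤ s * (1 / 2) ^ j := by
  rw [div_eq_mul_inv, one_div, inv_pow]
  exact mul_le_mul_right (inv_anti₀ (by positivity) (hN j)) s

theorem summable_geometric_half (s : ℝ≥0) : Summable fun j : ℕ => s * (1 / 2 : ℝ≥0) ^ j :=
  (NNReal.summable_coe.1 (by simpa using summable_geometric_two)).mul_left s

theorem summable_truncSum (hN : ∀ j, 2 ^ j ≤ N j) (s : ℝ≥0) :
    Summable fun j => min 1 (s / N j) :=
  NNReal.summable_of_le (fun j => (min_le_right _ _).trans (div_le_mul_geometric hN s j))
    (summable_geometric_half s)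

theorem truncSum_zero (N : ℕ → ℝ≥0) : truncSum N 0 = 0 := by
  simp [truncSum]

theorem truncSum_le (hN : ∀ j, 2 ^ j ≤ N j) (s : ℝ≥0) : truncSum N s ≤ s * 2 := by
  have h2 : ∑' j : ℕ, (1 / 2 : ℝ≥0) ^ j = 2 := NNReal.eq (by push_cast; exact tsum_geometric_two)
  rw [← h2, ← NNReal.tsum_mul_left]
  exact (summable_truncSum hN s).tsum_le_tsum
    (fun j => (min_le_right _ _).trans (div_le_mul_geometric hN s j)) (summable_geometric_half s)

theorem truncSum_mono (hN : ∀ j, 2 ^ j ≤ N j) : Monotone (truncSum N) := fun s t hst =>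
  (summable_truncSum hN s).tsum_le_tsum (fun j => by gcongr) (summable_truncSum hN t)

theorem truncSum_add_le (hN : ∀ j, 2 ^ j ≤ N j) (s t : ℝ≥0) :
    truncSum N (s + t) ≤ truncSum N s + truncSum N t := by
  rw [truncSum, truncSum, truncSum,
    ← (summable_truncSum hN s).tsum_add (summable_truncSum hN t)]
  refine (summable_truncSum hN _).tsum_le_tsum (fun j => ?_)
    ((summable_truncSum hN s).add (summable_truncSum hN t))
  rw [add_div]
  rcases le_total 1 (s / N j) with h | h
  · rw [min_eq_left h]
    exact (min_le_left _ _).trans le_self_add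
  rcases le_total 1 (t / N j) with h' | h'
  · rw [min_eq_left h']
    exact (min_le_left _ _).trans le_add_self
  · rw [min_eq_right h, min_eq_right h']
    exact min_le_right _ _

/-- The slow growth of `φ` makes integrability of `f φ(f)` insensitive to rescaling of `f`; this is
what later places inputs in `E_Φ` and not merely in `L_Φ`. -/
theorem truncSum_mul_le (hN : ∀ j, 2 ^ j ≤ N j) {k : ℝ≥0} (hk : 1 ≤ k) (s : ℝ≥0) :
    truncSum N (k * s) ≤ k * truncSum N s := by
  rw [truncSum, truncSum, ← NNReal.tsum_mul_left]
  refine (summable_truncSum hN _).tsum_le_tsum (fun j => ?_) ((summable_truncSum hN s).mul_left k)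
  rw [mul_min, mul_one, mul_div_assoc]
  exact min_le_min_right _ hk

theorem truncSum_pos (hN : ∀ j, 2 ^ j ≤ N j) {s : ℝ≥0} (hs : 0 < s) : 0 < truncSum N s := by
  have hN0 : 0 < N 0 := lt_of_lt_of_le (by norm_num) (hN 0)
  have h0 : 0 < min 1 (s / N 0) := lt_min one_pos (div_pos hs hN0)
  exact h0.trans_le ((summable_truncSum hN s).le_tsum 0 fun _ _ => zero_le)

/-- Subadditivity and the linear bound give an increment of at most `2(x - s)`. -/
theorem truncSum_continuousWithinAt (hN : ∀ j, 2 ^ j ≤ N j) (s : ℝ≥0) :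
    ContinuousWithinAt (truncSum N) (Ici s) s := by
  have hlim : Tendsto (fun x => truncSum N s + (x - s) * 2) (𝓝[Ici s] s) (𝓝 (truncSum N s)) := by
    have : Continuous fun x : ℝ≥0 => truncSum N s + (x - s) * 2 := by fun_prop
    simpa using (this.tendsto s).mono_left nhdsWithin_le_nhds
  refine tendsto_of_tendsto_of_tendsto_of_le_of_le' tendsto_const_nhds hlim ?_ ?_
  · filter_upwards [self_mem_nhdsWithin] with x hx using truncSum_mono hN hx
  · filter_upwards [self_mem_nhdsWithin] with x hx
    calc truncSum N x = truncSum N (s + (x - s)) := by rw [add_tsub_cancel_of_le hx]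
      _ ≤ _ := (truncSum_add_le hN _ _).trans (add_le_add_right (truncSum_le hN _) _)

/-- Each summand saturates at `1`, so the first `n` of them eventually contribute `n`. -/
theorem truncSum_tendsto (hN : ∀ j, 2 ^ j ≤ N j) : Tendsto (truncSum N) atTop atTop := by
  refine tendsto_atTop.2 fun b => ?_
  obtain ⟨n, hn⟩ := exists_nat_ge b
  have : ∀ᶠ s in atTop, ∀ j ∈ Finset.range n, N j ≤ s :=
    (Finset.eventually_all _).2 fun j _ => eventually_ge_atTop (N j)
  filter_upwards [this] with s hs
  refine hn.trans ?_
  calc (n : ℝ≥0) = ∑ j ∈ Finset.range n, min 1 (s / N j) := by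
        rw [Finset.sum_congr rfl fun j hj => min_eq_left ((one_le_div
          ((pow_pos two_pos j).trans_le (hN j))).2 (hs j hj))]
        simp
    _ ≤ truncSum N s := (summable_truncSum hN s).sum_le_tsum _ fun _ _ => zero_le

/-- The primitive of `truncSum N`. -/
noncomputable def truncYoung (N : ℕ → ℝ≥0) (t : ℝ≥0) : ℝ≥0 :=
  (∫ s in (0 : ℝ)..t, (truncSum N s.toNNReal : ℝ)).toNNReal

theorem coe_truncYoung (N : ℕ → ℝ≥0) (t : ℝ≥0) :
    (truncYoung N t : ℝ) = ∫ s in (0 : ℝ)..t, (truncSum N s.toNNReal : ℝ) :=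
  Real.coe_toNNReal _ (intervalIntegral.integral_nonneg t.coe_nonneg fun _ _ => NNReal.coe_nonneg _)

theorem isYoungFunction_truncYoung (hN : ∀ j, 2 ^ j ≤ N j) : IsYoungFunction (truncYoung N) :=
  ⟨truncSum N, truncSum_continuousWithinAt hN, truncSum_mono hN, truncSum_zero N,
    fun _ => truncSum_pos hN, truncSum_tendsto hN, coe_truncYoung N⟩

theorem truncYoung_le (hN : ∀ j, 2 ^ j ≤ N j) (s : ℝ≥0) : truncYoung N s ≤ s * truncSum N s := by
  rw [← NNReal.coe_le_coe, coe_truncYoung]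
  have hφ : Monotone fun s : ℝ => (truncSum N s.toNNReal : ℝ) :=
    fun x y hxy => NNReal.coe_le_coe.2 (truncSum_mono hN (Real.toNNReal_mono hxy))
  have h : ∫ x in (0 : ℝ)..s, (truncSum N x.toNNReal : ℝ) ≤ ∫ _ in (0 : ℝ)..s, (truncSum N s : ℝ) := by
    refine intervalIntegral.integral_mono_on s.coe_nonneg hφ.intervalIntegrable (by simp)
      fun x hx => NNReal.coe_le_coe.2 (truncSum_mono hN ?_)
    exact Real.toNNReal_le_iff_le_coe.2 hx.2
  simpa using h

end

/-! ### The de la Vallée Poussin argument. -/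

section

variable {α : Type*} [MeasurableSpace α] {μ : Measure α} {f : α → ℝ≥0}

/-- The integrals tend to zero as `N` grows, by dominated convergence with majorant `f`. The rate
`2⁻ʲ` makes them summable over `j`. -/
theorem exists_lintegral_mul_min_le (hf : AEMeasurable f μ) (hi : ∫⁻ a, f a ∂μ < ∞) (j : ℕ) :
    ∃ N : ℝ≥0, 2 ^ j ≤ N ∧ ∫⁻ a, (f a * min 1 (f a / N) : ℝ≥0) ∂μ ≤ (2⁻¹ : ℝ≥0∞) ^ j := by
  have hlim : Tendsto (fun n : ℕ => ∫⁻ a, (f a * min 1 (f a / (n : ℝ≥0)) : ℝ≥0) ∂μ) atTop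
      (𝓝 (∫⁻ _, 0 ∂μ)) := by
    refine tendsto_lintegral_of_dominated_convergence' (fun a => (f a : ℝ≥0∞)) (fun n => ?_)
      (fun n => ae_of_all _ fun a => ?_) hi.ne (ae_of_all _ fun a => ?_)
    · exact (hf.mul (aemeasurable_const.min (hf.div_const _))).coe_nnreal_ennreal
    · exact ENNReal.coe_le_coe.2 (mul_le_of_le_one_right zero_le (min_le_left _ _))
    · rw [← ENNReal.coe_zero]
      refine ENNReal.tendsto_coe.2 ?_
      have h1 : Tendsto (fun n : ℕ => f a / (n : ℝ≥0)) atTop (𝓝 0) :=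
        tendsto_const_div_atTop_nhds_zero_nat (f a)
      have h2 : Tendsto (fun n : ℕ => min 1 (f a / (n : ℝ≥0))) atTop (𝓝 (min 1 0)) :=
        tendsto_const_nhds.min h1
      simpa using h2.const_mul (f a)
  rw [lintegral_zero] at hlim
  have hpos : (0 : ℝ≥0∞) < 2⁻¹ ^ j := ENNReal.pow_pos (by simp) j
  obtain ⟨n, hn1, hn2⟩ := ((hlim.eventually_le_const hpos).and
    (tendsto_natCast_atTop_atTop.eventually_ge_atTop ((2 : ℝ≥0) ^ j))).exists
  exact ⟨n, hn2, hn1⟩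

/-- The de la Vallée Poussin criterion: every integrable function is integrable after composition
with a suitable Young function, even after arbitrary rescaling. -/
theorem exists_isYoungFunction_lintegral_lt_top (hf : AEMeasurable f μ)
    (hi : ∫⁻ a, f a ∂μ < ∞) :
    ∃ Φ, IsYoungFunction Φ ∧ ∀ k : ℝ≥0, ∫⁻ a, Φ (k * f a) ∂μ < ∞ := by
  choose N hN hNi using exists_lintegral_mul_min_le hf hi
  refine ⟨truncYoung N, isYoungFunction_truncYoung hN, fun k => ?_⟩
  have hsum : ∫⁻ a, (f a * truncSum N (f a) : ℝ≥0) ∂μ < ∞ := by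
    have h : ∀ a, ((f a * truncSum N (f a) : ℝ≥0) : ℝ≥0∞) =
        ∑' j, ((f a * min 1 (f a / N j) : ℝ≥0) : ℝ≥0∞) := fun a => by
      rw [truncSum, ← NNReal.tsum_mul_left, ENNReal.coe_tsum ((summable_truncSum hN _).mul_left _)]
    have hm : ∀ j, AEMeasurable (fun a => ((f a * min 1 (f a / N j) : ℝ≥0) : ℝ≥0∞)) μ := fun j =>
      (hf.mul (aemeasurable_const.min (hf.div_const _))).coe_nnreal_ennreal
    simp_rw [h]
    rw [lintegral_tsum hm]
    refine (ENNReal.tsum_le_tsum hNi).trans_lt ?_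
    rw [ENNReal.tsum_geometric, ENNReal.one_sub_inv_two, inv_inv]
    exact ENNReal.ofNat_lt_top
  -- One factor `max 1 k` comes from `Φ(s) ≤ s φ(s)`, the other from rescaling inside `φ`, which
  -- needs a factor at least `1`.
  have hle : ∀ a, ((truncYoung N (k * f a) : ℝ≥0) : ℝ≥0∞) ≤
      ((max 1 k * max 1 k : ℝ≥0) : ℝ≥0∞) * ((f a * truncSum N (f a) : ℝ≥0) : ℝ≥0∞) := fun a => by
    rw [← ENNReal.coe_mul]
    refine ENNReal.coe_le_coe.2 ?_
    calc truncYoung N (k * f a) ≤ truncYoung N (max 1 k * f a) :=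
          (isYoungFunction_truncYoung hN).monotone (mul_le_mul_left (le_max_right _ _) _)
      _ ≤ (max 1 k * f a) * truncSum N (max 1 k * f a) := truncYoung_le hN _
      _ ≤ (max 1 k * f a) * (max 1 k * truncSum N (f a)) :=
          mul_le_mul_right (truncSum_mul_le hN (le_max_left _ _) _) _
      _ = _ := by ring
  refine (lintegral_mono hle).trans_lt ?_
  rw [lintegral_const_mul' _ _ ENNReal.coe_ne_top]
  exact ENNReal.mul_lt_top ENNReal.coe_lt_top hsum

end

/-! ### Membership in `E_Φ` by truncation. -/

section

variable {U : Type*} [NormedAddCommGroup U] {Φ : ℝ≥0 → ℝ≥0} {t : ℝ≥0} {u : ℝ → U}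

/-- Truncations of `u` converge in the Luxemburg norm: the modular of the tail at each fixed scale
tends to zero by dominated convergence, the majorant being integrable because all scales are assumed
finite. -/
theorem mem_inputE_of_lintegral_lt_top (hΦ : IsYoungFunction Φ)
    (hu : AEStronglyMeasurable u (intervalMeasure t))
    (h : ∀ k : ℝ≥0, ∫⁻ s, (Φ (k * ‖u s‖₊) : ℝ≥0∞) ∂(intervalMeasure t) < ∞) :
    u ∈ (inputE U Φ).carrier t := by
  refine ⟨⟨hu, 1, one_pos, h _⟩, fun ε hε => ?_⟩
  let S : ℕ → Set ℝ := fun n => {s | ‖u s‖ ≤ n}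
  have hS : ∀ n, NullMeasurableSet (S n) (intervalMeasure t) := fun n =>
    nullMeasurableSet_le hu.norm.aemeasurable aemeasurable_const
  have hv : ∀ n, AEStronglyMeasurable ((S n).indicator u) (intervalMeasure t) := fun n =>
    hu.indicator₀ (hS n)
  -- Scale `ε / 2` leaves room for the strict inequality in the definition of `E_Φ`.
  have hε2 : 0 < ε / 2 := half_pos hε
  have hlim : Tendsto (fun n => ∫⁻ s, (Φ ((ε / 2)⁻¹ * ‖(u - (S n).indicator u) s‖₊) : ℝ≥0∞)
      ∂(intervalMeasure t)) atTop (𝓝 (∫⁻ _, 0 ∂(intervalMeasure t))) := by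
    refine tendsto_lintegral_of_dominated_convergence' _ (fun n => ?_)
      (fun n => ae_of_all _ fun s => ?_) (h (ε / 2)⁻¹).ne (ae_of_all _ fun s => ?_)
    · exact (hΦ.monotone.measurable.comp_aemeasurable
        ((hu.sub (hv n)).nnnorm.aemeasurable.const_mul _)).coe_nnreal_ennreal
    · refine ENNReal.coe_le_coe.2 (hΦ.monotone (mul_le_mul_right ?_ _))
      by_cases hs : s ∈ S n <;> simp [hs]
    · obtain ⟨n₀, hn₀⟩ := exists_nat_ge ‖u s‖
      refine tendsto_const_nhds.congr' ?_
      filter_upwards [eventually_ge_atTop n₀] with n hn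
      have hs : s ∈ S n := hn₀.trans (Nat.cast_le.2 hn)
      simp [hs, hΦ.map_zero]
  rw [lintegral_zero] at hlim
  obtain ⟨n, hn⟩ := (hlim.eventually_le_const one_pos).exists
  refine ⟨(S n).indicator u, ?_, ?_⟩
  · refine memLp_top_of_bound (hv n) n (ae_of_all _ fun s => ?_)
    by_cases hs : s ∈ S n
    · rw [indicator_of_mem hs]
      exact hs
    · simp [hs]
  · have hle : luxemburgNorm Φ t (u - (S n).indicator u) ≤ ε / 2 :=
      csInf_le (OrderBot.bddBelow _) ⟨hε2, hn⟩
    exact hle.trans_lt (half_lt_self hε)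

end

/-! ### From Orlicz stability back to `L¹`, and the equivalence. -/

section

variable {𝕜 X U : Type*} [RCLike 𝕜] [NormedAddCommGroup X] [NormedSpace 𝕜 X]
  [NormedAddCommGroup U] [NormedSpace 𝕜 U]
  {T : C0Semigroup 𝕜 X} {β : T.rho} {B : U →L[𝕜] T.Extrap β}

/-- Orlicz stability for all Young functions gives `L¹`-admissibility, as every integrable input
lies in some `E_Φ`. -/
theorem isL1Admissible_of_forall_isISS_E
    (h : ∀ Φ : ℝ≥0 → ℝ≥0, IsYoungFunction Φ → IsISS T β B (inputE U Φ)) :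
    T.IsL1Admissible β B := by
  intro u hu
  have hu' : Integrable u (intervalMeasure 1) := by
    simpa only [intervalMeasure, NNReal.coe_one, IntegrableOn] using hu
  obtain ⟨Φ, hΦ, hΦu⟩ := exists_isYoungFunction_lintegral_lt_top
    (f := fun s => ‖u s‖₊) hu'.1.nnnorm.aemeasurable hu'.2
  obtain ⟨b, μ, -, -, hb⟩ := h Φ hΦ
  obtain ⟨x, hx, -⟩ := hb 1 0 u (mem_inputE_of_lintegral_lt_top hΦ hu'.1 hΦu)
  exact ⟨x, by simpa [C0Semigroup.mildSolution_zero_state] using hx⟩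

theorem exists_isYoungFunction : ∃ Φ, IsYoungFunction Φ :=
  ⟨_, isYoungFunction_truncYoung (N := fun j => 2 ^ j) fun _ => le_rfl⟩

end


theorem mainTheorem3 {𝕜 X U : Type*} [RCLike 𝕜]
    [NormedAddCommGroup X] [NormedSpace 𝕜 X] [CompleteSpace X]
    [NormedAddCommGroup U] [NormedSpace 𝕜 U] [CompleteSpace U]
    (T : C0Semigroup 𝕜 X) (β : T.rho) (B : U →L[𝕜] T.Extrap β) :
    List.TFAE
      [IsISS T β B (inputL1 U),
        IsIISS T β B (inputL1 U),
        ∀ Φ : ℝ≥0 → ℝ≥0, IsYoungFunction Φ → IsISS T β B (inputE U Φ)] := by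
  tfae_have 1 → 2 := fun h => h.isIISS_L1
  tfae_have 2 → 3 := fun h Φ hΦ => by
    obtain ⟨b, hb⟩ := h.exists_isStableWith
    exact hb.isISS_E h.isL1Admissible hΦ
  tfae_have 3 → 1 := fun h => by
    -- Any single Young function yields the decay; admissibility uses a different one for each
    -- input.
    obtain ⟨Φ, hΦ⟩ := exists_isYoungFunction
    obtain ⟨b, hb⟩ := (h Φ hΦ).exists_isStableWith (zero_mem_inputE hΦ)
    exact hb.isISS_L1 (isL1Admissible_of_forall_isISS_E h)
  tfae_finish
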